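/- Let $n\ge 1$. Let $P$ be the transition matrix of the lazy random walk on $\{0,1\}^n$: from $x$, choose a coordinate $i\in\{1,\dots,n\}$ uniformly at random and an independent uniform bit $R\in\{0,1\}$, and replace $x_i$ by $x_i\oplus R$. Let $f:\{0,1\}^n\to\{0,1\}^n$ be the linear shift register $f(x)=(x_2,\dots,x_n,\ x_1\oplus\cdots\oplus x_n)$, let $\Pi$ be its permutation matrix ($\Pi_{x,y}=1$ if $y=f(x)$ and $0$ otherwise), and let $Q_1=P\Pi$. Let $\pi$ be the uniform distribution on $\{0,1\}^n$, which is stationary for $Q_1$, let $\|\mu-\nu\|_{\rm TV}=\frac12\sum_y|\mu(y)-\nu(y)|$, and put $$d_n(t)=\max_{x\in\{0,1\}^n}\|Q_1^t(x,\cdot)-\pi\|_{\rm TV},\qquad t_{\rm mix}^{(n)}=\min\{t\ge 0: d_n(t)<1/4\}.$$ (i) For every $n\ge 5$, $\ d_n(n+1)\le \dfrac2n$. (ii) Let $1/2<\alpha<1$ and let $t_n=n-n^\alpha$, rounded to an integer (up or down, or more generally let $t_n\geq 0$ be any integers with $|t_n-(n-n^\alpha)|\le 1$). Then, as $n\to\infty$,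 $$d_n(t_n)\ \ge\ \|Q_1^{t_n}(\mathbf 0,\cdot)-\pi\|_{\rm TV}\ \ge\ 1-o(1).$$ Consequently the sequence of chains has a cutoff at time $n$ with a window of size at most $n^{1/2+\delta}$ for any $\delta>0$: for every $\delta>0$ there are integers $0\le w_n\le n^{1/2+\delta}$ such that, both for $s_n=n$ and for $s_n=t_{\rm mix}^{(n)}$, one has $w_n=o(s_n)$, $\ \lim_{n\to\infty}d_n(s_n+w_n)=0\ $ and $\ \lim_{n\to\infty}d_n(s_n-w_n)=1$. -/

import Mathlib

open Filter Topology Asymptotics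

namespace ShiftRegister

noncomputable section

/-- The hypercube `{0,1}^n`; bits are elements of `ZMod 2`, so that `⊕` is `+`.
The coordinate `x_{i+1}` of the usual `1`-based notation is `x i`. -/
abbrev Cube (n : ℕ) : Type := Fin n → ZMod 2

/-- The total variation distance of two probability vectors on a finite set. -/
def tvDist {S : Type*} [Fintype S] (μ ν : S → ℝ) : ℝ := (1 / 2) * ∑ y, |μ y - ν y|

/-- The uniform distribution on `{0,1}^n`. -/
def unif (n : ℕ) : Cube n → ℝ := fun _ => 1 / (2 : ℝ) ^ n

/-- The lazy random walk: a uniformly random coordinate `i` and an independent uniform bit `r`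
are drawn, and `r` is added to the bit at `i`. -/
def lazyWalk (n : ℕ) : Matrix (Cube n) (Cube n) ℝ := fun x y =>
  ∑ i : Fin n, ∑ r : ZMod 2,
    (1 / (n : ℝ)) * (1 / 2) * (if y = Function.update x i (x i + r) then 1 else 0)

/-- The linear shift register `(x_1, …, x_n) ↦ (x_2, …, x_n, x_1 ⊕ ⋯ ⊕ x_n)`. -/
def shift {n : ℕ} (x : Cube n) : Cube n := fun i =>
  if h : (i : ℕ) + 1 < n then x ⟨(i : ℕ) + 1, h⟩ else ∑ j, x j

/-- The permutation matrix of the shift register. -/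
def shiftMatrix (n : ℕ) : Matrix (Cube n) (Cube n) ℝ := fun x y =>
  if y = shift x then 1 else 0

/-- The transition matrix `Q₁ = P Π`. -/
def Q₁ (n : ℕ) : Matrix (Cube n) (Cube n) ℝ := lazyWalk n * shiftMatrix n

/-- The worst-case total variation distance from uniform at time `t`. -/
def dist (n t : ℕ) : ℝ := ⨆ x : Cube n, tvDist ((Q₁ n ^ t) x) (unif n)

/-- The mixing time `min {t ≥ 0 : d_n(t) < ε}`. -/
def tmix (n : ℕ) (ε : ℝ) : ℕ := sInf {t : ℕ | dist n t < ε}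

/-- A sequence of chains with worst-case distances `d n` has a cutoff at the times `t n` with
window `w n`. The differences are eventually not truncated because `w = o(t)`, and, the distances
lying in `[0,1]`, the two limits say `limsup d(t + w) = 0` and `liminf d(t - w) = 1`. -/
def IsCutoff (d : ℕ → ℕ → ℝ) (t w : ℕ → ℕ) : Prop :=
  ((fun n => (w n : ℝ)) =o[atTop] fun n => (t n : ℝ)) ∧
    Tendsto (fun n => d n (t n + w n)) atTop (𝓝 0) ∧
    Tendsto (fun n => d n (t n - w n)) atTop (𝓝 1)

lemma shift_injective (n : ℕ) : Function.Injective (shift (n := n)) := by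
  intro x y h
  have key : ∀ i : Fin n, (i : ℕ) ≠ 0 → x i = y i := by
    intro i hi
    have h1 := congrFun h ⟨(i : ℕ) - 1, by omega⟩
    have h2 : (i : ℕ) - 1 + 1 = i := by omega
    simpa [shift, h2] using h1
  funext i
  by_cases hi : (i : ℕ) = 0
  · have h1 := congrFun h ⟨n - 1, by omega⟩
    have h2 : ¬ (n - 1 + 1 < n) := by omega
    simp only [shift, h2, dite_false] at h1
    rw [← Finset.add_sum_erase _ _ (Finset.mem_univ i),
      ← Finset.add_sum_erase _ y (Finset.mem_univ i)] at h1
    rw [Finset.sum_congr rfl (g := y)] at h1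
    · exact add_right_cancel h1
    · intro j hj
      apply key
      intro hj0
      exact (Finset.mem_erase.1 hj).1 (Fin.ext (by omega))
  · exact key i hi

lemma lazyWalk_rowSum (n : ℕ) (hn : 1 ≤ n) (x : Cube n) : ∑ y, lazyWalk n x y = 1 := by
  have hn' : (n : ℝ) ≠ 0 := by positivity
  simp only [lazyWalk]
  rw [Finset.sum_comm]
  simp_rw [Finset.sum_comm (s := (Finset.univ : Finset (Cube n))), ← Finset.mul_sum]
  simp
  field_simp

lemma lazyWalk_symm (n : ℕ) (x y : Cube n) : lazyWalk n x y = lazyWalk n y x := by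
  have h2 : ∀ r : ZMod 2, r + r = 0 := by decide
  have aux : ∀ (x y : Cube n) (i : Fin n) (r : ZMod 2),
      y = Function.update x i (x i + r) → x = Function.update y i (y i + r) := by
    rintro x y i r rfl
    funext j
    by_cases hj : j = i
    · subst hj; simp [add_assoc, h2]
    · simp [hj]
  simp only [lazyWalk]
  refine Finset.sum_congr rfl fun i _ => Finset.sum_congr rfl fun r _ => ?_
  congr 1
  exact if_congr ⟨aux x y i r, aux y x i r⟩ rfl rfl

/-- The rows of `Q₁` are probability vectors. -/
lemma Q₁_rowSum (n : ℕ) (hn : 1 ≤ n) (x : Cube n) : ∑ y, Q₁ n x y = 1 := by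
  simp only [Q₁, Matrix.mul_apply]
  rw [Finset.sum_comm]
  simp_rw [← Finset.mul_sum]
  simp [shiftMatrix, lazyWalk_rowSum n hn x]

/-- The uniform distribution is stationary for `Q₁`. -/
lemma unif_stationary (n : ℕ) (hn : 1 ≤ n) : Matrix.vecMul (unif n) (Q₁ n) = unif n := by
  have hb : Function.Bijective (shift (n := n)) :=
    Finite.injective_iff_bijective.1 (shift_injective n)
  have hP : Matrix.vecMul (unif n) (lazyWalk n) = unif n := by
    funext y
    simp only [Matrix.vecMul, dotProduct, unif, ← Finset.mul_sum]
    simp_rw [fun x => lazyWalk_symm n x y]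
    rw [lazyWalk_rowSum n hn y, mul_one]
  rw [Q₁, ← Matrix.vecMul_vecMul, hP]
  funext y
  obtain ⟨x, rfl⟩ := hb.2 y
  simp only [Matrix.vecMul, dotProduct, unif, shiftMatrix, ← Finset.mul_sum, hb.1.eq_iff]
  simp

end

end ShiftRegister

/-! Append to `x` its parity bit. The shift register then rotates n+1 positions cyclically, and a
lazy step adds one random bit both at a random position and at the parity slot. So each character
`walsh S` is an eigenvector of the lazy walk, and `Q₁` sends it to a multiple of the rotated
character. Seen from a fixed `S`, the parity slot moves back by one position per step
(`Q₁_pow_mulVec_walsh`).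

Upper bound: in n+1 steps the slot visits every position once, so a set of size m has Fourier
coefficient ± `fullMultiplier n m`. Up to C(n+1,m) this is a term of a binomial expansion with sum
at most 1, hence it is at most 1/C(n+1,m). Parseval and Cauchy–Schwarz give 2/n.

Lower bound: for t < n the slot has missed the first n-t coordinates. From 0, their signs have a
common mean of at least e⁻² and nonpositive correlations. The sum of these signs has mean of order
n-t and variance at most n-t, against mean 0 under uniform, so the distance tends to 1 whenever n-t
→ ∞. Hence the window √n suffices. -/

namespace ShiftRegister

noncomputable section

open Matrix

/-! ### Signs and the register extended by its parity -/

/-- The nontrivial sign character of `ZMod 2`. -/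
def sgn (b : ZMod 2) : ℝ := if b = 0 then 1 else -1

@[simp] lemma sgn_zero : sgn 0 = 1 := by simp [sgn]

@[simp] lemma sgn_one : sgn 1 = -1 := by simp [sgn]

lemma zmod_two_cases (b : ZMod 2) : b = 0 ∨ b = 1 := by
  revert b; decide

lemma sgn_add (a b : ZMod 2) : sgn (a + b) = sgn a * sgn b := by
  have h : (1 : ZMod 2) + 1 = 0 := by decide
  rcases zmod_two_cases a with rfl | rfl <;> rcases zmod_two_cases b with rfl | rfl <;> simp [h]

lemma sgn_mul_self (a : ZMod 2) : sgn a * sgn a = 1 := by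
  rcases zmod_two_cases a with rfl | rfl <;> simp

lemma sum_zmod_two (g : ZMod 2 → ℝ) : ∑ b, g b = g 0 + g 1 := Fin.sum_univ_two g

/-- A vector of bits followed by its parity. -/
def parityExt {n : ℕ} (x : Cube n) : Fin (n + 1) → ZMod 2 :=
  Fin.snoc (α := fun _ => ZMod 2) x (∑ i, x i)

@[simp] lemma parityExt_castSucc {n : ℕ} (x : Cube n) (i : Fin n) :
    parityExt x i.castSucc = x i := by simp [parityExt]

@[simp] lemma parityExt_last {n : ℕ} (x : Cube n) :
    parityExt x (Fin.last n) = ∑ i, x i := by simp [parityExt]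

/-- The shift register is the cyclic rotation of the vector extended by its parity. -/
lemma parityExt_shift {n : ℕ} (x : Cube n) (j : Fin (n + 1)) :
    parityExt (shift x) j = parityExt x (j + 1) := by
  have h2 : ∀ b : ZMod 2, b + b = 0 := by decide
  cases n with
  | zero =>
    have h : j + 1 = j := Fin.ext (by omega)
    rw [h, Subsingleton.elim (shift x) x]
  | succ n =>
    induction j using Fin.lastCases with
    | last =>
      have h0 : Fin.last (n + 1) + 1 = Fin.castSucc 0 := by simp
      rw [h0, parityExt_last, parityExt_castSucc, Fin.sum_univ_castSucc]
      simp only [shift, Fin.val_castSucc, Fin.val_last]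
      rw [dif_neg (by omega), Fin.sum_univ_succ (f := x)]
      have : ∀ i : Fin n, (if h : (i : ℕ) + 1 < n + 1 then x ⟨i + 1, h⟩ else x 0 + ∑ i : Fin n, x i.succ)
          = x i.succ := fun i => by rw [dif_pos (by omega)]; rfl
      simp_rw [this]
      -- The new parity is the tail sum plus the whole old sum; the tail cancels and leaves `x 0`.
      rw [add_left_comm, h2, add_zero]
    | cast i =>
      rw [Fin.coeSucc_eq_succ, parityExt_castSucc]
      induction i using Fin.lastCases with
      | last => rw [Fin.succ_last, parityExt_last]; simp [shift]
      | cast i =>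
        rw [Fin.succ_castSucc, parityExt_castSucc]
        simp only [shift, Fin.val_castSucc]
        rw [dif_pos (by omega)]; rfl

lemma parityExt_update {n : ℕ} (x : Cube n) (i : Fin n) (r : ZMod 2) (j : Fin (n + 1)) :
    parityExt (Function.update x i (x i + r)) j =
      parityExt x j + ((if j = i.castSucc then r else 0) + if j = Fin.last n then r else 0) := by
  induction j using Fin.lastCases with
  | last =>
    have h : Fin.last n ≠ i.castSucc := (Fin.castSucc_lt_last i).ne'
    simp only [parityExt_last, h, if_true, if_false, zero_add]
    rw [← Finset.add_sum_erase _ _ (Finset.mem_univ i),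
      ← Finset.add_sum_erase _ x (Finset.mem_univ i),
      Finset.sum_congr rfl (g := x)]
    · simp; ring
    · intro j hj
      simp [(Finset.mem_erase.1 hj).1]
  | cast k =>
    have h : k.castSucc ≠ Fin.last n := (Fin.castSucc_lt_last k).ne
    by_cases hk : k = i
    · subst hk; simp [h]
    · simp [h, hk]

/-! ### Action of the chain on characters -/

/-- The character of the cube attached to a set of positions of the extended vector. -/
def walsh {n : ℕ} (S : Finset (Fin (n + 1))) (x : Cube n) : ℝ := ∏ j ∈ S, sgn (parityExt x j)

/-- The set `S` rotated by one position. -/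
def rot {n : ℕ} (S : Finset (Fin (n + 1))) : Finset (Fin (n + 1)) :=
  S.map (Equiv.addRight 1).toEmbedding

lemma mem_rot {n : ℕ} (S : Finset (Fin (n + 1))) (j : Fin (n + 1)) : j ∈ rot S ↔ j - 1 ∈ S := by
  simp only [rot, Finset.mem_map_equiv, Equiv.addRight_symm, Equiv.coe_addRight, sub_eq_add_neg]

@[simp] lemma card_rot {n : ℕ} (S : Finset (Fin (n + 1))) : (rot S).card = S.card := by simp [rot]

lemma walsh_shift {n : ℕ} (S : Finset (Fin (n + 1))) (x : Cube n) :
    walsh S (shift x) = walsh (rot S) x := by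
  simp [walsh, rot, parityExt_shift]

/-- The multiplier of `walsh S` for a randomization step whose parity bit sits at position `j`. -/
def multiplier {n : ℕ} (S : Finset (Fin (n + 1))) (j : Fin (n + 1)) : ℝ :=
  if j ∈ S then ((S.card : ℝ) - 1) / n else ((n : ℝ) - S.card) / n

lemma multiplier_rot {n : ℕ} (S : Finset (Fin (n + 1))) (j : Fin (n + 1)) :
    multiplier (rot S) j = multiplier S (j - 1) := by
  simp [multiplier, mem_rot]

lemma lazyWalk_mulVec {n : ℕ} (g : Cube n → ℝ) (x : Cube n) :
    (lazyWalk n *ᵥ g) x =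
      ∑ i : Fin n, ∑ r : ZMod 2, (1 / (n : ℝ)) * (1 / 2) * g (Function.update x i (x i + r)) := by
  simp only [mulVec, dotProduct, lazyWalk, Finset.sum_mul]
  rw [Finset.sum_comm]
  refine Finset.sum_congr rfl fun i _ => ?_
  rw [Finset.sum_comm]
  refine Finset.sum_congr rfl fun r _ => ?_
  simp [mul_assoc]

lemma walsh_update {n : ℕ} (S : Finset (Fin (n + 1))) (x : Cube n) (i : Fin n) (r : ZMod 2) :
    walsh S (Function.update x i (x i + r)) = walsh S x *
      ((if i.castSucc ∈ S then sgn r else 1) * if Fin.last n ∈ S then sgn r else 1) := by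
  simp only [walsh, parityExt_update, sgn_add, Finset.prod_mul_distrib]
  congr 1
  simp [apply_ite sgn]

lemma card_eq_sum_castSucc {n : ℕ} (S : Finset (Fin (n + 1))) :
    (S.card : ℝ) = (∑ i : Fin n, if i.castSucc ∈ S then (1 : ℝ) else 0)
      + if Fin.last n ∈ S then 1 else 0 := by
  rw [← Fin.sum_univ_castSucc (f := fun j => if j ∈ S then (1 : ℝ) else 0)]
  simp

/-- Averaging over the bit kills the choice `i` unless `S` contains both or neither of `i` and the
parity slot. The multiplier is the proportion of surviving `i`. -/
lemma lazyWalk_mulVec_walsh {n : ℕ} (S : Finset (Fin (n + 1))) :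
    lazyWalk n *ᵥ walsh S = multiplier S (Fin.last n) • walsh S := by
  funext x
  rw [lazyWalk_mulVec]
  have h := card_eq_sum_castSucc S
  simp only [sum_zmod_two, walsh_update, sgn_zero, sgn_one, Pi.smul_apply, smul_eq_mul, multiplier]
  by_cases hl : Fin.last n ∈ S
  · simp only [hl, if_true] at h ⊢
    rw [h, add_sub_cancel_right, Finset.sum_div, Finset.sum_mul]
    refine Finset.sum_congr rfl fun i _ => ?_
    split_ifs <;> ring
  · simp only [hl, if_false, add_zero] at h ⊢
    have h' : (n : ℝ) - S.card = ∑ i : Fin n, (1 - if i.castSucc ∈ S then (1 : ℝ) else 0) := by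
      rw [h]; simp
    rw [h', Finset.sum_div, Finset.sum_mul]
    refine Finset.sum_congr rfl fun i _ => ?_
    split_ifs <;> ring

lemma shiftMatrix_mulVec {n : ℕ} (g : Cube n → ℝ) : shiftMatrix n *ᵥ g = fun x => g (shift x) := by
  funext x
  simp [mulVec, dotProduct, shiftMatrix]

lemma Q₁_mulVec_walsh {n : ℕ} (S : Finset (Fin (n + 1))) :
    Q₁ n *ᵥ walsh S = multiplier S (Fin.last n - 1) • walsh (rot S) := by
  have : shiftMatrix n *ᵥ walsh S = walsh (rot S) := by
    rw [shiftMatrix_mulVec]; funext x; exact walsh_shift S x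
  rw [Q₁, ← mulVec_mulVec, this, lazyWalk_mulVec_walsh, multiplier_rot]

/-! ### Orbit of the parity slot -/

/-- The position of the parity bit `k` steps ago. -/
def pos (n k : ℕ) : Fin (n + 1) := (fun j => j - 1)^[k] (Fin.last n)

lemma pos_succ (n k : ℕ) : pos n (k + 1) = pos n k - 1 := by
  rw [pos, Function.iterate_succ_apply', ← pos]

lemma val_pos {n k : ℕ} (hk : k ≤ n) : (pos n k : ℕ) = n - k := by
  induction k with
  | zero => simp [pos]
  | succ k ih =>
    have h := ih (by omega)
    rw [pos_succ, Fin.coe_sub_one, if_neg, h, Nat.sub_sub]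
    intro h0
    rw [h0] at h
    simp at h
    omega

lemma pos_full (n : ℕ) : pos n (n + 1) = Fin.last n := by
  rw [pos_succ]
  apply Fin.ext
  rw [Fin.coe_sub_one, if_pos]
  · simp
  · exact Fin.ext (by rw [val_pos le_rfl]; simp)

lemma prod_pos_full {n : ℕ} (F : Fin (n + 1) → ℝ) :
    ∏ k ∈ Finset.range (n + 1), F (pos n (k + 1)) = ∏ j, F j := by
  rw [Finset.prod_range_succ, pos_full, Fin.prod_univ_castSucc]
  congr 1
  rw [Finset.prod_range, ← Equiv.prod_comp Fin.revPerm]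
  refine Finset.prod_congr rfl fun i _ => ?_
  congr 1
  apply Fin.ext
  have hi := i.isLt
  rw [val_pos (by simp only [Fin.revPerm_apply, Fin.val_rev]; omega)]
  simp only [Fin.revPerm_apply, Fin.val_rev, Fin.val_castSucc]
  omega

lemma Q₁_pow_mulVec_walsh {n : ℕ} (t : ℕ) (S : Finset (Fin (n + 1))) :
    Q₁ n ^ t *ᵥ walsh S =
      (∏ k ∈ Finset.range t, multiplier S (pos n (k + 1))) • walsh (rot^[t] S) := by
  induction t generalizing S with
  | zero => simp
  | succ t ih =>
    rw [pow_succ, ← mulVec_mulVec, Q₁_mulVec_walsh, mulVec_smul, ih, smul_smul,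
      Finset.prod_range_succ', Function.iterate_succ_apply, mul_comm]
    simp only [multiplier_rot, ← pos_succ]
    rfl

/-! ### Fourier analysis on the cube -/

/-- The character attached to a set of coordinates. -/
def chi {n : ℕ} (T : Finset (Fin n)) (x : Cube n) : ℝ := ∏ i ∈ T, sgn (x i)

lemma walsh_map_castSucc {n : ℕ} (T : Finset (Fin n)) (x : Cube n) :
    walsh (T.map Fin.castSuccEmb) x = chi T x := by
  simp [walsh, chi]

lemma abs_sgn (b : ZMod 2) : |sgn b| = 1 := by
  rcases zmod_two_cases b with rfl | rfl <;> simp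

lemma abs_walsh {n : ℕ} (S : Finset (Fin (n + 1))) (x : Cube n) : |walsh S x| = 1 := by
  simp [walsh, Finset.abs_prod, abs_sgn]

lemma walsh_zero {n : ℕ} (S : Finset (Fin (n + 1))) : walsh S (0 : Cube n) = 1 := by
  refine Finset.prod_eq_one fun j _ => ?_
  induction j using Fin.lastCases <;> simp

lemma sum_chi {n : ℕ} {T : Finset (Fin n)} (hT : T.Nonempty) : ∑ x : Cube n, chi T x = 0 := by
  obtain ⟨i, hi⟩ := hT
  have h : ∀ x : Cube n, chi T x = ∏ j, if j ∈ T then sgn (x j) else 1 := fun x => by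
    simp [chi]
  simp_rw [h]
  rw [← Fintype.prod_sum (f := fun j b => if j ∈ T then sgn b else 1)]
  refine Finset.prod_eq_zero (Finset.mem_univ i) ?_
  rw [sum_zmod_two]
  simp [hi]

lemma sum_unif_mul_chi {n : ℕ} {T : Finset (Fin n)} (hT : T.Nonempty) :
    ∑ x : Cube n, unif n x * chi T x = 0 := by
  simp only [unif, ← Finset.mul_sum, sum_chi hT, mul_zero]

/-- The sum over `T` factors as the product over `i` of 1 + `sgn (x i) * sgn (y i)`, which vanishes
as soon as one coordinate differs. -/
lemma sum_chi_mul_chi {n : ℕ} (x y : Cube n) :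
    ∑ T : Finset (Fin n), chi T x * chi T y = if x = y then (2 : ℝ) ^ n else 0 := by
  simp only [chi, ← Finset.prod_mul_distrib]
  rw [← Finset.powerset_univ, ← Finset.prod_one_add]
  split_ifs with h
  · subst h
    simp [sgn_mul_self]
    norm_num
  · obtain ⟨i, hi⟩ := Function.ne_iff.1 h
    refine Finset.prod_eq_zero (Finset.mem_univ i) ?_
    rcases zmod_two_cases (x i) with h1 | h1 <;> rcases zmod_two_cases (y i) with h2 | h2 <;>
      simp_all

/-- Parseval's identity. -/
lemma sum_sq_fourier {n : ℕ} (f : Cube n → ℝ) :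
    ∑ T : Finset (Fin n), (∑ x, f x * chi T x) ^ 2 = 2 ^ n * ∑ x, f x ^ 2 := by
  have h : ∀ T : Finset (Fin n), (∑ x, f x * chi T x) ^ 2
      = ∑ x, ∑ y, f x * f y * (chi T x * chi T y) := fun T => by
    rw [sq, Finset.sum_mul_sum]
    exact Finset.sum_congr rfl fun x _ => Finset.sum_congr rfl fun y _ => by ring
  simp_rw [h]
  rw [Finset.sum_comm, Finset.mul_sum]
  refine Finset.sum_congr rfl fun x _ => ?_
  rw [Finset.sum_comm]
  simp_rw [← Finset.mul_sum, sum_chi_mul_chi]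
  simp
  ring

/-! ### Total variation and the distance from uniform -/

lemma lazyWalk_nonneg (n : ℕ) (x y : Cube n) : 0 ≤ lazyWalk n x y :=
  Finset.sum_nonneg fun i _ => Finset.sum_nonneg fun r _ => by positivity

lemma Q₁_nonneg (n : ℕ) (x y : Cube n) : 0 ≤ Q₁ n x y := by
  rw [Q₁, mul_apply]
  refine Finset.sum_nonneg fun z _ => mul_nonneg (lazyWalk_nonneg n x z) ?_
  unfold shiftMatrix
  positivity

lemma Q₁_pow_nonneg (n t : ℕ) (x y : Cube n) : 0 ≤ (Q₁ n ^ t) x y := by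
  induction t generalizing y with
  | zero => rw [pow_zero, one_apply]; positivity
  | succ t ih =>
    rw [pow_succ, mul_apply]
    exact Finset.sum_nonneg fun z _ => mul_nonneg (ih z) (Q₁_nonneg n z y)

lemma Q₁_pow_rowSum {n : ℕ} (hn : 1 ≤ n) (t : ℕ) (x : Cube n) : ∑ y, (Q₁ n ^ t) x y = 1 := by
  induction t with
  | zero => simp [one_apply]
  | succ t ih =>
    simp only [pow_succ, mul_apply]
    rw [Finset.sum_comm]
    simp_rw [← Finset.mul_sum, Q₁_rowSum n hn, mul_one, ih]

lemma unif_nonneg (n : ℕ) (x : Cube n) : 0 ≤ unif n x := by unfold unif; positivity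

lemma sum_unif (n : ℕ) : ∑ x, unif n x = 1 := by simp [unif]

lemma tvDist_nonneg {S : Type*} [Fintype S] (μ ν : S → ℝ) : 0 ≤ tvDist μ ν := by
  unfold tvDist; positivity

/-- The total variation distance of two probability vectors is one minus their overlap. -/
lemma tvDist_eq_one_sub {S : Type*} [Fintype S] {μ ν : S → ℝ}
    (hμ : ∑ y, μ y = 1) (hν : ∑ y, ν y = 1) :
    tvDist μ ν = 1 - ∑ y, min (μ y) (ν y) := by
  have h : ∀ y, |μ y - ν y| = μ y + ν y - 2 * min (μ y) (ν y) := fun y => by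
    rcases le_total (μ y) (ν y) with h | h
    · rw [min_eq_left h, abs_of_nonpos (by linarith)]; ring
    · rw [min_eq_right h, abs_of_nonneg (by linarith)]; ring
  simp only [tvDist, h, Finset.sum_sub_distrib, Finset.sum_add_distrib, ← Finset.mul_sum, hμ, hν]
  ring

lemma tvDist_le_one {S : Type*} [Fintype S] {μ ν : S → ℝ} (hμ0 : ∀ y, 0 ≤ μ y)
    (hν0 : ∀ y, 0 ≤ ν y) (hμ : ∑ y, μ y = 1) (hν : ∑ y, ν y = 1) : tvDist μ ν ≤ 1 := by
  rw [tvDist_eq_one_sub hμ hν]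
  have : 0 ≤ ∑ y, min (μ y) (ν y) := Finset.sum_nonneg fun y _ => le_min (hμ0 y) (hν0 y)
  linarith

/-- Second moment bound: a statistic that concentrates around `a` under `μ` and around `0` under
`ν` separates the two. -/
lemma one_sub_le_tvDist {S : Type*} [Fintype S] {μ ν : S → ℝ} (hμ0 : ∀ y, 0 ≤ μ y)
    (hν0 : ∀ y, 0 ≤ ν y) (hμ : ∑ y, μ y = 1) (hν : ∑ y, ν y = 1) {F : S → ℝ} {a V : ℝ}
    (ha : 0 < a) (h1 : ∑ y, μ y * (F y - a) ^ 2 ≤ V) (h2 : ∑ y, ν y * F y ^ 2 ≤ V) :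
    1 - 4 * V / a ^ 2 ≤ tvDist μ ν := by
  rw [tvDist_eq_one_sub hμ hν, sub_le_sub_iff_left, le_div_iff₀ (by positivity)]
  have key : (∑ y, min (μ y) (ν y)) * (a ^ 2 / 2)
      ≤ ∑ y, μ y * (F y - a) ^ 2 + ∑ y, ν y * F y ^ 2 := by
    rw [Finset.sum_mul, ← Finset.sum_add_distrib]
    refine Finset.sum_le_sum fun y _ => ?_
    have hm := le_min (hμ0 y) (hν0 y)
    calc min (μ y) (ν y) * (a ^ 2 / 2)
        ≤ min (μ y) (ν y) * ((F y - a) ^ 2 + F y ^ 2) := by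
          refine mul_le_mul_of_nonneg_left ?_ hm
          -- The difference of the two sides is (2F - a)²/2.
          nlinarith [sq_nonneg (2 * F y - a)]
      _ = min (μ y) (ν y) * (F y - a) ^ 2 + min (μ y) (ν y) * F y ^ 2 := by ring
      _ ≤ _ := add_le_add (mul_le_mul_of_nonneg_right (min_le_left _ _) (sq_nonneg _))
          (mul_le_mul_of_nonneg_right (min_le_right _ _) (sq_nonneg _))
  linarith

lemma tvDist_le_dist (n t : ℕ) (x : Cube n) : tvDist ((Q₁ n ^ t) x) (unif n) ≤ dist n t :=
  le_ciSup (f := fun x => tvDist ((Q₁ n ^ t) x) (unif n)) (Set.finite_range _).bddAbove x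

lemma dist_nonneg (n t : ℕ) : 0 ≤ dist n t :=
  (tvDist_nonneg _ _).trans (tvDist_le_dist n t 0)

lemma dist_le_one {n : ℕ} (hn : 1 ≤ n) (t : ℕ) : dist n t ≤ 1 :=
  ciSup_le fun x => tvDist_le_one (Q₁_pow_nonneg n t x) (unif_nonneg n) (Q₁_pow_rowSum hn t x)
    (sum_unif n)

/-- A stochastic matrix contracts the ℓ¹ norm and fixes the uniform distribution. -/
lemma dist_antitone {n : ℕ} (hn : 1 ≤ n) : Antitone (dist n) := by
  refine antitone_nat_of_succ_le fun t => ciSup_le fun x => ?_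
  refine le_trans ?_ (tvDist_le_dist n t x)
  unfold tvDist
  refine mul_le_mul_of_nonneg_left ?_ (by norm_num)
  have h : ∀ y, |(Q₁ n ^ (t + 1)) x y - unif n y|
      ≤ ∑ z, |(Q₁ n ^ t) x z - unif n z| * Q₁ n z y := fun y => by
    have h1 : unif n y = ∑ z, unif n z * Q₁ n z y := (congrFun (unif_stationary n hn) y).symm
    rw [pow_succ, mul_apply, h1, ← Finset.sum_sub_distrib]
    refine (Finset.abs_sum_le_sum_abs _ _).trans (Finset.sum_le_sum fun z _ => ?_)
    rw [← sub_mul, abs_mul, abs_of_nonneg (Q₁_nonneg n z y)]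
  refine (Finset.sum_le_sum fun y _ => h y).trans ?_
  rw [Finset.sum_comm]
  simp_rw [← Finset.mul_sum, Q₁_rowSum n hn, mul_one]
  exact le_rfl

/-! ### Upper bound at time n + 1 -/

/-- The size of the Fourier coefficients after `n + 1` steps, for sets of `m` positions. -/
def fullMultiplier (n m : ℕ) : ℝ :=
  (((m : ℝ) - 1) / n) ^ m * (((n : ℝ) - m) / n) ^ (n + 1 - m)

lemma prod_multiplier {n : ℕ} (S : Finset (Fin (n + 1))) :
    ∏ j, multiplier S j = fullMultiplier n S.card := by
  simp only [multiplier, Finset.prod_ite, Finset.prod_const, fullMultiplier]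
  congr 2
  · simp
  · rw [← Finset.compl_filter, Finset.card_compl]; simp

lemma fourier_full_sq {n : ℕ} (T : Finset (Fin n)) (x : Cube n) :
    (∑ y, (Q₁ n ^ (n + 1)) x y * chi T y) ^ 2 = fullMultiplier n T.card ^ 2 := by
  have h := congrFun (Q₁_pow_mulVec_walsh (n + 1) (T.map Fin.castSuccEmb)) x
  rw [prod_pos_full, prod_multiplier, Finset.card_map] at h
  simp only [mulVec, dotProduct, walsh_map_castSucc, Pi.smul_apply, smul_eq_mul] at h
  rw [h, mul_pow, ← sq_abs (walsh _ x), abs_walsh, one_pow, mul_one]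

lemma fullMultiplier_nonneg {n m : ℕ} (hm : 1 ≤ m) (hmn : m ≤ n) : 0 ≤ fullMultiplier n m := by
  have h1 : (1 : ℝ) ≤ m := by exact_mod_cast hm
  have h2 : (m : ℝ) ≤ n := by exact_mod_cast hmn
  unfold fullMultiplier
  have h3 : 0 ≤ (m : ℝ) - 1 := by linarith
  have h4 : 0 ≤ (n : ℝ) - m := by linarith
  positivity

/-- The left side is one term of the expansion of ((m-1)/n + (n-m)/n)^(n+1), whose base is (n-1)/n.
-/
lemma choose_mul_fullMultiplier_le {n m : ℕ} (hm : 1 ≤ m) (hmn : m ≤ n) :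
    ((n + 1).choose m : ℝ) * fullMultiplier n m ≤ 1 := by
  have h1 : (1 : ℝ) ≤ m := by exact_mod_cast hm
  have h2 : (m : ℝ) ≤ n := by exact_mod_cast hmn
  have h0 : (0 : ℝ) < n := by linarith
  have h3 : 0 ≤ ((m : ℝ) - 1) / n := div_nonneg (by linarith) h0.le
  have h4 : 0 ≤ ((n : ℝ) - m) / n := div_nonneg (by linarith) h0.le
  have h5 : ((m : ℝ) - 1) / n + ((n : ℝ) - m) / n ≤ 1 := by
    rw [← add_div, div_le_one h0]; linarith
  calc ((n + 1).choose m : ℝ) * fullMultiplier n m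
      = (((m : ℝ) - 1) / n) ^ m * (((n : ℝ) - m) / n) ^ (n + 1 - m) * (n + 1).choose m := by
        rw [fullMultiplier, mul_comm]
    _ ≤ (((m : ℝ) - 1) / n + ((n : ℝ) - m) / n) ^ (n + 1) := by
        rw [add_pow]
        exact Finset.single_le_sum
          (f := fun k => (((m : ℝ) - 1) / n) ^ k * (((n : ℝ) - m) / n) ^ (n + 1 - k)
            * ((n + 1).choose k : ℝ)) (fun k _ => by positivity) (Finset.mem_range.2 (by omega))
    _ ≤ 1 := pow_le_one₀ (by positivity) h5

lemma choose_three_le {N k : ℕ} (h3 : 3 ≤ k) (hk : k + 3 ≤ N) : N.choose 3 ≤ N.choose k := by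
  have aux : ∀ k, 3 ≤ k → k ≤ N / 2 → N.choose 3 ≤ N.choose k := by
    intro k hk
    induction k, hk using Nat.le_induction with
    | base => exact fun _ => le_rfl
    | succ k hk ih =>
      exact fun h => (ih (by omega)).trans (Nat.choose_le_succ_of_lt_half_left (by omega))
  rcases le_or_gt k (N / 2) with h | h
  · exact aux k h3 h
  · rw [← Nat.choose_symm (show k ≤ N by omega)]
    exact aux _ (by omega) (by omega)

lemma cast_choose_three (n : ℕ) :
    ((n + 1).choose 3 : ℝ) = ((n : ℝ) + 1) * n * (n - 1) / 6 := by
  have h := congrArg (Nat.cast : ℕ → ℝ) (Nat.add_one_mul_choose_eq n 2)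
  push_cast [Nat.cast_choose_two] at h
  linarith

/-- The binomial bound is used twice: to absorb the coefficient with one factor, then to bound the
other by 1/C(n+1,m). Sizes 1 and n contribute zero; sizes 2 and n-1 give the indicator terms; all
others satisfy C(n+1,m) ≥ C(n+1,3). -/
lemma choose_mul_fullMultiplier_sq_le {n m : ℕ} (hn : 5 ≤ n) (hm : 1 ≤ m) (hmn : m ≤ n) :
    (n.choose m : ℝ) * fullMultiplier n m ^ 2 ≤
      (if m = 2 then 2 / (n * (n + 1) : ℝ) else 0) +
      (if m = n - 1 then 2 / (n * (n + 1) : ℝ) else 0) + 6 / ((n + 1) * n * (n - 1) : ℝ) := by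
  have hn' : (5 : ℝ) ≤ n := by exact_mod_cast hn
  have hn1 : (0 : ℝ) < n - 1 := by linarith
  have h0 := fullMultiplier_nonneg hm hmn
  have hle : (n.choose m : ℝ) * fullMultiplier n m ^ 2 ≤ fullMultiplier n m := by
    have h1 := choose_mul_fullMultiplier_le hm hmn
    have h2 : (n.choose m : ℝ) ≤ (n + 1).choose m := by
      exact_mod_cast Nat.choose_le_choose m (Nat.le_succ n)
    calc (n.choose m : ℝ) * fullMultiplier n m ^ 2
        = (n.choose m : ℝ) * fullMultiplier n m * fullMultiplier n m := by ring
      _ ≤ 1 * fullMultiplier n m :=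
        mul_le_mul_of_nonneg_right ((mul_le_mul_of_nonneg_right h2 h0).trans h1) h0
      _ = _ := one_mul _
  have hinv : ∀ c : ℝ, 0 < c → c ≤ (n + 1).choose m → fullMultiplier n m ≤ 1 / c := by
    intro c hc hcm
    rw [le_div_iff₀ hc, mul_comm]
    exact (mul_le_mul_of_nonneg_right hcm h0).trans (choose_mul_fullMultiplier_le hm hmn)
  refine hle.trans ?_
  have hA : (0 : ℝ) ≤ 2 / (n * (n + 1) : ℝ) := by positivity
  have hB : (0 : ℝ) ≤ 6 / ((n + 1) * n * (n - 1) : ℝ) := by positivity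
  have hC : 1 / ((n : ℝ) * (n + 1) / 2) = 2 / (n * (n + 1) : ℝ) := one_div_div _ _
  have hch2 : ((n + 1).choose 2 : ℝ) = (n : ℝ) * (n + 1) / 2 := by
    rw [Nat.cast_choose_two]; push_cast; ring
  by_cases e1 : m = 1
  · subst e1
    have : fullMultiplier n 1 = 0 := by simp [fullMultiplier]
    rw [this]
    positivity
  by_cases e2 : m = n
  · subst e2
    have : fullMultiplier m m = 0 := by simp [fullMultiplier]
    rw [this]
    positivity
  by_cases e3 : m = 2
  · have h := hinv ((n : ℝ) * (n + 1) / 2) (by positivity) (by rw [e3, hch2])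
    rw [hC] at h
    rw [if_pos e3]
    split_ifs <;> linarith
  by_cases e4 : m = n - 1
  · have h := hinv ((n : ℝ) * (n + 1) / 2) (by positivity) (by
      rw [← hch2, ← Nat.choose_symm (show m ≤ n + 1 by omega), show n + 1 - m = 2 by omega])
    rw [hC] at h
    rw [if_pos e4]
    rw [if_neg e3]; linarith
  have h := hinv (((n : ℝ) + 1) * n * (n - 1) / 6) (by positivity) (by
    rw [← cast_choose_three]
    exact_mod_cast choose_three_le (by omega) (by omega))
  rw [one_div_div] at h
  rw [if_neg e3, if_neg e4]
  linarith

lemma sum_choose_mul_fullMultiplier_sq_le {n : ℕ} (hn : 5 ≤ n) :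
    ∑ m ∈ Finset.Icc 1 n, (n.choose m : ℝ) * fullMultiplier n m ^ 2 ≤ 16 / (n : ℝ) ^ 2 := by
  have hn' : (5 : ℝ) ≤ n := by exact_mod_cast hn
  have hn1 : (0 : ℝ) < n - 1 := by linarith
  refine (Finset.sum_le_sum fun m hm => choose_mul_fullMultiplier_sq_le hn
    (Finset.mem_Icc.1 hm).1 (Finset.mem_Icc.1 hm).2).trans ?_
  simp only [Finset.sum_add_distrib, Finset.sum_ite_eq', Finset.mem_Icc, Finset.sum_const,
    Nat.card_Icc, nsmul_eq_mul]
  rw [if_pos (by omega), if_pos (by omega), Nat.add_sub_cancel]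
  have h1 : 2 / ((n : ℝ) * (n + 1)) ≤ 2 / (n : ℝ) ^ 2 :=
    div_le_div_of_nonneg_left (by norm_num) (by positivity) (by nlinarith)
  have h2 : (n : ℝ) * (6 / ((n + 1) * n * (n - 1))) ≤ 12 / (n : ℝ) ^ 2 := by
    rw [mul_div_assoc', div_le_div_iff₀ (by positivity) (by positivity)]
    nlinarith [mul_nonneg (show (0 : ℝ) ≤ n by linarith) (show (0 : ℝ) ≤ (n : ℝ) ^ 2 - 2 by nlinarith)]
  have h3 : 2 / (n : ℝ) ^ 2 + 2 / (n : ℝ) ^ 2 + 12 / (n : ℝ) ^ 2 = 16 / (n : ℝ) ^ 2 := by ring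
  linarith

lemma dist_full_le {n : ℕ} (hn : 5 ≤ n) : dist n (n + 1) ≤ 2 / (n : ℝ) := by
  have hn0 : (0 : ℝ) < n := by exact_mod_cast (show 0 < n by omega)
  refine ciSup_le fun x => ?_
  set f : Cube n → ℝ := fun y => (Q₁ n ^ (n + 1)) x y - unif n y with hf
  have hcoef : ∀ T : Finset (Fin n), (∑ y, f y * chi T y) ^ 2
      = if T.card = 0 then 0 else fullMultiplier n T.card ^ 2 := fun T => by
    simp only [hf, sub_mul, Finset.sum_sub_distrib]
    split_ifs with hT
    -- The trivial character sees only the total masses, which are both 1.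
    · rw [Finset.card_eq_zero] at hT
      simp [hT, chi, Q₁_pow_rowSum (show 1 ≤ n by omega), sum_unif]
    · rw [sum_unif_mul_chi (Finset.card_ne_zero.1 hT), sub_zero, fourier_full_sq]
  have hsum : ∑ T : Finset (Fin n), (∑ y, f y * chi T y) ^ 2 ≤ 16 / (n : ℝ) ^ 2 := by
    simp_rw [hcoef]
    rw [← Finset.powerset_univ, Finset.sum_powerset_apply_card
      (fun m => if m = 0 then (0 : ℝ) else fullMultiplier n m ^ 2), Finset.card_univ,
      Fintype.card_fin, Finset.sum_range_succ']
    refine le_trans (le_of_eq ?_) (sum_choose_mul_fullMultiplier_sq_le hn)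
    rw [← Finset.Ico_add_one_right_eq_Icc, Finset.sum_Ico_eq_sum_range]
    simp [add_comm]
  -- Cauchy–Schwarz costs the size 2^n of the cube, exactly the factor in Parseval.
  have hcs : (∑ y, |f y|) ^ 2 ≤ 16 / (n : ℝ) ^ 2 := by
    have h := sq_sum_le_card_mul_sum_sq (s := (Finset.univ : Finset (Cube n))) (f := fun y => |f y|)
    simp only [sq_abs] at h
    refine h.trans ?_
    rw [sum_sq_fourier] at hsum
    simpa using hsum
  have h4 : ∑ y, |f y| ≤ 4 / n := by
    refine abs_le_of_sq_le_sq' ?_ (by positivity) |>.2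
    rw [div_pow]
    norm_num
    exact hcs
  calc tvDist ((Q₁ n ^ (n + 1)) x) (unif n) = 1 / 2 * ∑ y, |f y| := rfl
    _ ≤ 1 / 2 * (4 / n) := by linarith
    _ = 2 / n := by ring

/-! ### Lower bound before time n -/

/-- The first `t` steps have not yet moved the parity bit to the first `n - t` coordinates. -/
lemma fourier_unvisited {n t : ℕ} (ht : t ≤ n) {T : Finset (Fin n)}
    (hT : ∀ i ∈ T, (i : ℕ) < n - t) :
    ∑ y, (Q₁ n ^ t) 0 y * chi T y = (((n : ℝ) - T.card) / n) ^ t := by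
  have h := congrFun (Q₁_pow_mulVec_walsh t (T.map Fin.castSuccEmb)) (0 : Cube n)
  simp only [mulVec, dotProduct, walsh_map_castSucc, Pi.smul_apply, smul_eq_mul, walsh_zero,
    mul_one] at h
  rw [h, Finset.prod_congr rfl (g := fun _ => ((n : ℝ) - T.card) / n), Finset.prod_const,
    Finset.card_range]
  intro k hk
  rw [multiplier, if_neg, Finset.card_map]
  intro hmem
  obtain ⟨i, hi, hik⟩ := Finset.mem_map.1 hmem
  have h1 := congrArg Fin.val hik
  have h2 := hT i hi
  rw [Finset.mem_range] at hk
  rw [val_pos (by omega)] at h1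
  simp at h1
  omega

/-- A sum of signs with nonpositive correlations has variance at most the number of signs. -/
lemma variance_sum_sgn_le {n : ℕ} {w : Cube n → ℝ} (hw : ∑ y, w y = 1) (U : Finset (Fin n))
    {ρ τ : ℝ} (h1 : ∀ i ∈ U, ∑ y, w y * chi {i} y = ρ)
    (h2 : ∀ i ∈ U, ∀ j ∈ U, i ≠ j → ∑ y, w y * chi {i, j} y = τ) (hτ : τ ≤ ρ ^ 2) :
    ∑ y, w y * ((∑ i ∈ U, sgn (y i)) - U.card * ρ) ^ 2 ≤ U.card := by
  have h1' : ∀ i ∈ U, ∑ y, w y * sgn (y i) = ρ := fun i hi => by simpa [chi] using h1 i hi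
  have hexp : ∀ y : Cube n, w y * ((∑ i ∈ U, sgn (y i)) - U.card * ρ) ^ 2
      = ∑ i ∈ U, ∑ j ∈ U, (w y * (sgn (y i) * sgn (y j)) - ρ * (w y * sgn (y i))
        - ρ * (w y * sgn (y j)) + ρ ^ 2 * w y) := fun y => by
    have : (∑ i ∈ U, sgn (y i)) - U.card * ρ = ∑ i ∈ U, (sgn (y i) - ρ) := by simp
    rw [this, sq, Finset.sum_mul_sum, Finset.mul_sum]
    refine Finset.sum_congr rfl fun i _ => ?_
    rw [Finset.mul_sum]
    exact Finset.sum_congr rfl fun j _ => by ring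
  simp_rw [hexp]
  rw [Finset.sum_comm]
  have hcard : (U.card : ℝ) = ∑ i ∈ U, 1 := by simp
  rw [hcard]
  refine Finset.sum_le_sum fun i hi => ?_
  rw [Finset.sum_comm]
  have hone : (1 : ℝ) = ∑ j ∈ U, if j = i then 1 else 0 := by simp [hi]
  rw [hone]
  refine Finset.sum_le_sum fun j hj => ?_
  simp only [Finset.sum_add_distrib, Finset.sum_sub_distrib, ← Finset.mul_sum, h1' i hi, h1' j hj,
    hw]
  -- A diagonal term is 1 - ρ² ≤ 1, an off-diagonal one τ - ρ² ≤ 0.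
  split_ifs with hij
  · subst hij
    simp only [sgn_mul_self, mul_one, hw]
    nlinarith [sq_nonneg ρ]
  · have h := h2 i hi j hj (Ne.symm hij)
    simp only [chi, Finset.prod_pair (Ne.symm hij)] at h
    rw [h]
    linarith

/-- For n ≥ 2 one has 1 - 1/n ≥ e^(-2/n), and t ≤ n. -/
lemma exp_neg_two_le {n t : ℕ} (hn : 2 ≤ n) (ht : t ≤ n) :
    Real.exp (-2) ≤ (((n : ℝ) - 1) / n) ^ t := by
  have hn' : (2 : ℝ) ≤ n := by exact_mod_cast hn
  have ht' : (t : ℝ) ≤ n := by exact_mod_cast ht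
  have h0 : (0 : ℝ) < n - 1 := by linarith
  have h1 : Real.exp (-(2 / n)) ≤ ((n : ℝ) - 1) / n := by
    rw [Real.exp_neg, inv_le_comm₀ (Real.exp_pos _) (by positivity), inv_div]
    calc (n : ℝ) / (n - 1) ≤ 2 / n + 1 := by
          rw [div_le_iff₀ h0]
          have : (2 / (n : ℝ) + 1) * (n - 1) = n + (n - 2) / n := by field_simp; ring
          rw [this]
          have : 0 ≤ ((n : ℝ) - 2) / n := div_nonneg (by linarith) (by linarith)
          linarith
      _ ≤ _ := Real.add_one_le_exp _
  calc Real.exp (-2) ≤ Real.exp (t * (-(2 / n))) := by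
        refine Real.exp_le_exp.2 ?_
        have : (t : ℝ) * (2 / n) ≤ 2 := by
          rw [mul_div_assoc', div_le_iff₀ (by linarith)]; linarith
        linarith
    _ = Real.exp (-(2 / n)) ^ t := Real.exp_nat_mul _ t
    _ ≤ _ := pow_le_pow_left₀ (Real.exp_pos _).le h1 t

lemma one_sub_le_tvDist_zero {n t : ℕ} (hn : 2 ≤ n) (ht : t < n) :
    1 - 4 * Real.exp 4 / ((n : ℝ) - t) ≤ tvDist ((Q₁ n ^ t) 0) (unif n) := by
  have hn' : (2 : ℝ) ≤ n := by exact_mod_cast hn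
  set U : Finset (Fin n) := Finset.univ.filter fun i => (i : ℕ) < n - t with hU
  have hcard : (U.card : ℝ) = n - t := by
    have : U.card = n - t := by
      rw [hU, Fin.card_filter_val_lt]
      omega
    rw [this, Nat.cast_sub ht.le]
  have hM : (0 : ℝ) < n - t := by
    have : (t : ℝ) < n := by exact_mod_cast ht
    linarith
  set ρ : ℝ := (((n : ℝ) - 1) / n) ^ t with hρ
  have hρ0 : Real.exp (-2) ≤ ρ := exp_neg_two_le hn ht.le
  have hμ := Q₁_pow_rowSum (show 1 ≤ n by omega) t (0 : Cube n)
  have hmem : ∀ i ∈ U, (i : ℕ) < n - t := fun i hi => (Finset.mem_filter.1 hi).2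
  have hvarμ := variance_sum_sgn_le hμ U (ρ := ρ) (τ := (((n : ℝ) - 2) / n) ^ t)
    (fun i hi => by rw [fourier_unvisited ht.le (by simpa using hmem i hi)]; simp [hρ])
    (fun i hi j hj hij => by
      rw [fourier_unvisited ht.le (by simpa using ⟨hmem i hi, hmem j hj⟩), Finset.card_pair hij]
      simp)
    (by
      -- Nonpositive correlation reduces to n(n-2) ≤ (n-1)².
      rw [hρ, ← pow_mul, mul_comm, pow_mul]
      refine pow_le_pow_left₀ (div_nonneg (by linarith) (by linarith)) ?_ t
      rw [div_pow, div_le_div_iff₀ (by positivity) (by positivity)]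
      nlinarith)
  have hvarν := variance_sum_sgn_le (sum_unif n) U (ρ := 0) (τ := 0)
    (fun i _ => sum_unif_mul_chi (by simp)) (fun i _ j _ _ => sum_unif_mul_chi (by simp))
    (by simp)
  simp only [mul_zero, sub_zero] at hvarν
  rw [hcard] at hvarμ hvarν
  have hρpos : 0 < ρ := (Real.exp_pos _).trans_le hρ0
  refine le_trans ?_ (one_sub_le_tvDist (Q₁_pow_nonneg n t 0) (unif_nonneg n) hμ (sum_unif n)
    (mul_pos hM hρpos) hvarμ hvarν)
  rw [sub_le_sub_iff_left, div_le_div_iff₀ (by positivity) hM]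
  have h4 : 1 ≤ Real.exp 4 * ρ ^ 2 := by
    calc (1 : ℝ) = Real.exp 4 * Real.exp (-2) ^ 2 := by
          rw [← Real.exp_nat_mul, ← Real.exp_add]; norm_num
      _ ≤ _ := by gcongr
  nlinarith [mul_le_mul_of_nonneg_left h4 (sq_nonneg ((n : ℝ) - t))]

/-! ### Limits, mixing time and cutoff -/

/-- The distances from uniform tend to one along times that stay far below `n`. -/
lemma tendsto_tvDist_zero {t : ℕ → ℕ} (h : Tendsto (fun n : ℕ => (n : ℝ) - t n) atTop atTop) :
    Tendsto (fun n => tvDist ((Q₁ n ^ t n) 0) (unif n)) atTop (𝓝 1) := by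
  have hlow : Tendsto (fun n : ℕ => 1 - 4 * Real.exp 4 / ((n : ℝ) - t n)) atTop (𝓝 1) := by
    simpa using tendsto_const_nhds.sub (h.const_div_atTop (4 * Real.exp 4))
  refine tendsto_of_tendsto_of_tendsto_of_le_of_le' hlow tendsto_const_nhds ?_ ?_
  · filter_upwards [eventually_ge_atTop 2, h.eventually_gt_atTop 0] with n hn hpos
    exact one_sub_le_tvDist_zero hn (by exact_mod_cast sub_pos.1 hpos)
  · filter_upwards [eventually_ge_atTop 1] with n hn
    exact tvDist_le_one (Q₁_pow_nonneg n _ 0) (unif_nonneg n) (Q₁_pow_rowSum hn _ 0) (sum_unif n)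

lemma tendsto_dist_one {t : ℕ → ℕ} (h : Tendsto (fun n : ℕ => (n : ℝ) - t n) atTop atTop) :
    Tendsto (fun n => dist n (t n)) atTop (𝓝 1) := by
  refine tendsto_of_tendsto_of_tendsto_of_le_of_le' (tendsto_tvDist_zero h) tendsto_const_nhds
    (Eventually.of_forall fun n => tvDist_le_dist n _ 0) ?_
  filter_upwards [eventually_ge_atTop 1] with n hn
  exact dist_le_one hn _

lemma tendsto_dist_zero {t : ℕ → ℕ} (h : ∀ᶠ n in atTop, n + 1 ≤ t n) :
    Tendsto (fun n => dist n (t n)) atTop (𝓝 0) := by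
  refine tendsto_of_tendsto_of_tendsto_of_le_of_le' tendsto_const_nhds
    (tendsto_const_div_atTop_nhds_zero_nat (2 : ℝ)) (Eventually.of_forall fun n => dist_nonneg n _) ?_
  filter_upwards [eventually_ge_atTop 5, h] with n hn ht
  exact (dist_antitone (by omega) ht).trans (dist_full_le hn)

lemma tendsto_sqrt_atTop : Tendsto Nat.sqrt atTop atTop :=
  tendsto_atTop.2 fun b => by
    filter_upwards [eventually_ge_atTop (b * b)] with n hn
    exact Nat.le_sqrt.2 hn

/-- Times between `n + 1 - √n` and `n + 1` are cutoff times with window `√n`. -/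
lemma isCutoff_sqrt {s : ℕ → ℕ} (hlow : ∀ᶠ n in atTop, n + 1 ≤ s n + Nat.sqrt n)
    (hup : ∀ᶠ n in atTop, s n ≤ n + 1) : IsCutoff dist s Nat.sqrt := by
  have hcast : Tendsto (fun n => (Nat.sqrt n : ℝ)) atTop atTop :=
    tendsto_natCast_atTop_atTop.comp tendsto_sqrt_atTop
  refine ⟨?_, tendsto_dist_zero hlow, tendsto_dist_one ?_⟩
  · refine IsLittleO.of_bound fun c hc => ?_
    filter_upwards [hlow, hcast.eventually_ge_atTop (1 / c + 1)] with n hn hr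
    have h1 : (n : ℝ) + 1 ≤ s n + Nat.sqrt n := by exact_mod_cast hn
    have h2 : (Nat.sqrt n : ℝ) * Nat.sqrt n ≤ n := by exact_mod_cast Nat.sqrt_le n
    have h3 : 1 ≤ c * ((Nat.sqrt n : ℝ) - 1) := by
      calc (1 : ℝ) = c * (1 / c) := by field_simp
        _ ≤ _ := mul_le_mul_of_nonneg_left (by linarith) hc.le
    simp only [RCLike.norm_natCast]
    -- With r = √n rounded down, s ≥ n + 1 - r ≥ r(r - 1), so r = o(s).
    have h4 : (Nat.sqrt n : ℝ) * (Nat.sqrt n - 1) ≤ s n := by linarith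
    have h5 := mul_le_mul_of_nonneg_left h4 hc.le
    have h6 := mul_le_mul_of_nonneg_left h3 (Nat.cast_nonneg (α := ℝ) (Nat.sqrt n))
    linarith
  · refine tendsto_atTop_mono' _ ?_ (tendsto_atTop_add_const_right _ (-1) hcast)
    filter_upwards [hup, eventually_ge_atTop 1] with n hn h1
    have h2 := Nat.sqrt_le_self n
    have h3 : s n - Nat.sqrt n + Nat.sqrt n ≤ n + 1 := by omega
    have h4 : ((s n - Nat.sqrt n : ℕ) : ℝ) + Nat.sqrt n ≤ n + 1 := by exact_mod_cast h3
    linarith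

lemma tmix_le {n : ℕ} (hn : 9 ≤ n) : tmix n (1 / 4) ≤ n + 1 := by
  refine Nat.sInf_le ?_
  have hn' : (9 : ℝ) ≤ n := by exact_mod_cast hn
  refine (dist_full_le (show 5 ≤ n by omega)).trans_lt ?_
  rw [div_lt_div_iff₀ (by linarith) (by norm_num)]
  linarith

lemma lt_tmix {n t : ℕ} (hn : 9 ≤ n) (h : 1 / 4 ≤ dist n t) : t < tmix n (1 / 4) := by
  by_contra! hle
  -- Nonemptiness rules out the default value 0 of `sInf`; n ≥ 9 makes 2/n < 1/4.
  have hne : {t : ℕ | dist n t < 1 / 4}.Nonempty := by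
    refine ⟨n + 1, (dist_full_le (show 5 ≤ n by omega)).trans_lt ?_⟩
    have hn' : (9 : ℝ) ≤ n := by exact_mod_cast hn
    rw [div_lt_div_iff₀ (by linarith) (by norm_num)]
    linarith
  have h1 : dist n (tmix n (1 / 4)) < 1 / 4 := Nat.sInf_mem hne
  exact absurd (h.trans (dist_antitone (by omega) hle)) (not_le.2 h1)

lemma le_tmix_add_sqrt : ∀ᶠ n in atTop, n + 1 ≤ tmix n (1 / 4) + Nat.sqrt n := by
  have h : Tendsto (fun n => dist n (n - Nat.sqrt n)) atTop (𝓝 1) := by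
    refine tendsto_dist_one ?_
    have hcast : Tendsto (fun n => (Nat.sqrt n : ℝ)) atTop atTop :=
      tendsto_natCast_atTop_atTop.comp tendsto_sqrt_atTop
    refine hcast.congr fun n => ?_
    rw [Nat.cast_sub (Nat.sqrt_le_self n)]
    ring
  filter_upwards [h.eventually_const_le (show (1 / 4 : ℝ) < 1 by norm_num),
    eventually_ge_atTop 9] with n h1 hn
  have := lt_tmix hn h1
  omega

end

end ShiftRegister

theorem theorem1 :
    -- (i) the upper bound
    (∀ n : ℕ, 5 ≤ n → ShiftRegister.dist n (n + 1) ≤ 2 / (n : ℝ)) ∧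
    -- (ii) the lower bound, for either way of rounding `n - n ^ α`
    (∀ α : ℝ, 1 / 2 < α → α < 1 →
      ∀ t : ℕ → ℕ, (∀ n : ℕ, |(t n : ℝ) - ((n : ℝ) - (n : ℝ) ^ α)| ≤ 1) →
        ∃ ε : ℕ → ℝ, Tendsto ε atTop (𝓝 0) ∧ ∀ n : ℕ,
          ShiftRegister.tvDist ((ShiftRegister.Q₁ n ^ t n) 0) (ShiftRegister.unif n)
              ≤ ShiftRegister.dist n (t n) ∧
          1 - ε n ≤
            ShiftRegister.tvDist ((ShiftRegister.Q₁ n ^ t n) 0) (ShiftRegister.unif n)) ∧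
    -- cutoff at time `n`, and at the mixing time, with a window of size at most `n ^ (1 / 2 + δ)`
    (∀ δ : ℝ, 0 < δ →
      ∃ w : ℕ → ℕ, (∀ n : ℕ, (w n : ℝ) ≤ (n : ℝ) ^ (1 / 2 + δ)) ∧
        ShiftRegister.IsCutoff ShiftRegister.dist (fun n => n) w ∧
        ShiftRegister.IsCutoff ShiftRegister.dist
          (fun n => ShiftRegister.tmix n (1 / 4)) w) := by
  refine ⟨fun n hn => ShiftRegister.dist_full_le hn, ?_, ?_⟩
  · intro α hα _ t ht
    refine ⟨fun n => 1 - ShiftRegister.tvDist ((ShiftRegister.Q₁ n ^ t n) 0)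
      (ShiftRegister.unif n), ?_, fun n => ⟨ShiftRegister.tvDist_le_dist n _ 0, by simp⟩⟩
    have hgap : Tendsto (fun n : ℕ => (n : ℝ) - t n) atTop atTop := by
      have hpow : Tendsto (fun n : ℕ => (n : ℝ) ^ α) atTop atTop :=
        (tendsto_rpow_atTop (by linarith)).comp tendsto_natCast_atTop_atTop
      refine tendsto_atTop_mono (fun n => ?_) (tendsto_atTop_add_const_right _ (-1) hpow)
      linarith [(abs_le.1 (ht n)).2]
    simpa using (ShiftRegister.tendsto_tvDist_zero hgap).const_sub 1
  · intro δ hδ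
    refine ⟨Nat.sqrt, fun n => ?_, ShiftRegister.isCutoff_sqrt ?_ ?_,
      ShiftRegister.isCutoff_sqrt ShiftRegister.le_tmix_add_sqrt ?_⟩
    · rcases Nat.eq_zero_or_pos n with rfl | hn
      · simp
        positivity
      · calc (Nat.sqrt n : ℝ) ≤ √(n : ℝ) := Real.nat_sqrt_le_real_sqrt
          _ = (n : ℝ) ^ (1 / 2 : ℝ) := Real.sqrt_eq_rpow _
          _ ≤ _ := Real.rpow_le_rpow_of_exponent_le (by exact_mod_cast hn) (by linarith)
    -- A window of at least 1 carries time n past n + 1, where the upper bound starts.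
    · filter_upwards [eventually_ge_atTop 1] with n hn
      have := Nat.sqrt_pos.2 hn
      omega
    · exact Eventually.of_forall fun n => by omega
    · filter_upwards [eventually_ge_atTop 9] with n hn
      exact ShiftRegister.tmix_le hn
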